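/- Let $\mathbb{R}^\infty$ be the space of finitely supported real sequences with its standard inner product, and let $\mathcal{L}=\mathbb{L}(\mathbb{R}^\infty,\mathbb{R}^\infty)$ be the monoid of linear isometric embeddings $\mathbb{R}^\infty\to\mathbb{R}^\infty$ under composition. It is topologized as $\lim_V\operatorname{colim}_W\mathbb{L}(V,W)$, where $V,W$ range over the finite-dimensional subspaces of $\mathbb{R}^\infty$, $\mathbb{L}(V,W)$ has the Stiefel manifold topology, and the limit is formed in compactly generated spaces. A *universal subgroup* of $\mathcal{L}$ is a compact subgroup $G\subseteq\mathcal{L}$ that admits the structure of a Lie group and for which every finite-dimensional orthogonal $G$-representation embeds into $\mathbb{R}^\infty$ by a $G$-equivariant linear isometry. Let $H,G\subseteq\mathcal{L}$ be universal subgroups. Let $\operatorname{map}(H,G)$ be the space of continuous homomorphisms $H\to G$ with the compact-open topology and the right $G$-action $(\alpha\cdot g)(h)=g^{-1}\alpha(h)g$. Let $E(H,G)$ be the space $\mathcal{L}$ with the right $H\times G$-action $f\cdot(h,g)=h^{-1}\circ f\circ g$. For $\alpha\in\operatorname{map}(H,G)$ let $E(H,G)^\alpha=\{x\in E(H,G)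 : x\cdot(h,\alpha(h))=x \text{ for all } h\in H\}$ and let $C(\alpha)\subseteq G$ be the centralizer of the image of $\alpha$. Let $\tilde E(H,G)=\{(\alpha,x)\in\operatorname{map}(H,G)\times E(H,G) : x\in E(H,G)^\alpha\}$, with the subspace topology and the diagonal $G$-action, and let $\mathbf{O}_{\mathrm{gl}}(H,G)=(E(H,G)/G)^H$. Then the map $$\nu\colon \tilde E(H,G)/G\longrightarrow (E(H,G)/G)^H=\mathbf{O}_{\mathrm{gl}}(H,G),\qquad [\alpha,x]\mapsto[x],$$ is a well-defined homeomorphism. Moreover, for every family $(\alpha_i)_{i\in I}$ containing exactly one representative of each $G$-orbit in $\operatorname{map}(H,G)$, the maps $$\mu\colon\coprod_{i\in I}E(H,G)^{\alpha_i}/C(\alpha_i)\to\tilde E(H,G)/G,\qquad [x]\mapsto[\alpha_i,x]\quad (x\in E(H,G)^{\alpha_i}),$$ $$\lambda\colon\coprod_{i\in I}E(H,G)^{\alpha_i}/C(\alpha_i)\to\mathbf{O}_{\mathrm{gl}}(H,G),\qquad [x]\mapsto[x]\quad (x\in E(H,G)^{\alpha_i}),$$ are well-defined homeomorphisms, and $\nu\circ\mu=\lambda$.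 -/

import Mathlib

namespace OrbiGl

noncomputable section

open MulOpposite
open scoped Manifold ContDiff

/-! ### Spaces of linear isometric embeddings -/

/-- `ℝ^∞`: finitely supported real sequences. -/
def RInf : Type := ℕ →₀ ℝ

instance : AddCommGroup RInf := inferInstanceAs (AddCommGroup (ℕ →₀ ℝ))

instance : Module ℝ RInf := inferInstanceAs (Module ℝ (ℕ →₀ ℝ))

/-- The standard inner product `⟨x, y⟩ = ∑ i, x i * y i` of finitely supported sequences. -/
def finInner (x y : ℕ →₀ ℝ) : ℝ := x.sum fun i a => a * y i

/-- The standard inner product on `ℝ^∞`. -/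
@[reducible]
def RInf.core : InnerProductSpace.Core ℝ RInf where
  inner x y := finInner x y
  conj_inner_symm (x y : ℕ →₀ ℝ) := by
    change finInner y x = finInner x y
    unfold finInner
    rw [Finsupp.sum_of_support_subset x (Finset.subset_union_left (s₂ := y.support)) _ (by simp),
      Finsupp.sum_of_support_subset y (Finset.subset_union_right (s₁ := x.support)) _ (by simp)]
    exact Finset.sum_congr rfl fun i _ => mul_comm _ _
  re_inner_nonneg _ := Finset.sum_nonneg fun i _ => mul_self_nonneg _
  add_left _ _ _ := Finsupp.sum_add_index' (by simp) (by intros; ring)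
  smul_left (x y : ℕ →₀ ℝ) r := by
    change finInner (r • x) y = r * finInner x y
    unfold finInner
    refine (Finsupp.sum_smul_index' (by simp)).trans ?_
    simp only [Finsupp.sum, Finset.mul_sum, smul_eq_mul, mul_assoc]
  definite (x : ℕ →₀ ℝ) h := by
    have h0 := (Finset.sum_eq_zero_iff_of_nonneg (s := x.support)
      (f := fun i => x i * x i) fun i _ => mul_self_nonneg _).1 h
    refine Finsupp.ext fun i => ?_
    by_cases hi : i ∈ x.support
    · exact mul_self_eq_zero.1 (h0 i hi)
    · exact Finsupp.notMem_support_iff.1 hi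

instance : NormedAddCommGroup RInf := RInf.core.toNormedAddCommGroup

instance : InnerProductSpace ℝ RInf := InnerProductSpace.ofCore RInf.core.toCore

section Topology

variable (V W : Type) [NormedAddCommGroup V] [InnerProductSpace ℝ V]
  [NormedAddCommGroup W] [InnerProductSpace ℝ W]

/-- The topology of pointwise convergence on `L(V, W)`. For `V` and `W` of finite dimension this
is the topology of the Stiefel manifold, i.e. the subspace topology along
`f ↦ (f v₁, …, f v_k) ∈ W ^ k` for any basis `v₁, …, v_k` of `V`. -/
@[reducible]
def stiefelTopology : TopologicalSpace (V →ₗᵢ[ℝ] W) :=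
  TopologicalSpace.induced (fun f v => f v) Pi.topologicalSpace

/-- For `V` of finite dimension, the topology of `L(V, W) = colim_U L(V, U)`, where `U` ranges
over the finite-dimensional subspaces of `W`. -/
@[reducible]
def colimTopology : TopologicalSpace (V →ₗᵢ[ℝ] W) :=
  ⨆ (U : Submodule ℝ W) (_ : FiniteDimensional ℝ U),
    TopologicalSpace.coinduced (fun f : V →ₗᵢ[ℝ] U => U.subtypeₗᵢ.comp f) (stiefelTopology V U)

/-- The topology of the limit `L(V, W) = lim_U L(U, W)` formed in all topological spaces, where
`U` ranges over the finite-dimensional subspaces of `V`. -/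
@[reducible]
def limTopology : TopologicalSpace (V →ₗᵢ[ℝ] W) :=
  ⨅ (U : Submodule ℝ V) (_ : FiniteDimensional ℝ U),
    TopologicalSpace.induced (fun f : V →ₗᵢ[ℝ] W => f.comp U.subtypeₗᵢ) (colimTopology U W)

/-- The topology on `L(V, W)`: the limit `lim_U L(U, W)` formed in compactly generated spaces,
that is, the `k`-ification of the limit formed in all topological spaces. -/
@[reducible]
def isomTopology : TopologicalSpace (V →ₗᵢ[ℝ] W) :=
  @TopologicalSpace.compactlyGenerated.{0} (V →ₗᵢ[ℝ] W) (limTopology V W)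

end Topology

/-- The monoid `𝓛 = L(ℝ^∞, ℝ^∞)` under composition, with its compactly generated topology. -/
abbrev LMonoid : Type := RInf →ₗᵢ[ℝ] RInf

instance : TopologicalSpace LMonoid := isomTopology RInf RInf

/-! ### Universal subgroups -/

/-- A subgroup of the monoid `𝓛`: a submonoid all of whose elements are invertible in it. -/
structure LSubgroup extends Submonoid LMonoid where
  isUnit' : ∀ g : toSubmonoid, IsUnit g

instance (G : LSubgroup) : Group G.toSubmonoid := groupOfIsUnit G.isUnit'

/-- A compact subgroup of `𝓛` is universal if it admits the structure of a Lie group (for the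
subspace topology) and makes `ℝ^∞` into a complete universe, i.e. every finite-dimensional
orthogonal representation embeds into `ℝ^∞` by an equivariant linear isometry. -/
structure LSubgroup.IsUniversal (G : LSubgroup) : Prop where
  isCompact : IsCompact (G.toSubmonoid : Set LMonoid)
  exists_lieGroup : ∃ (n : ℕ) (_ : ChartedSpace (EuclideanSpace ℝ (Fin n)) G.toSubmonoid),
    LieGroup (𝓡 n) ∞ G.toSubmonoid
  complete : ∀ (V : Type) [NormedAddCommGroup V] [InnerProductSpace ℝ V] [FiniteDimensional ℝ V]
    (ρ : G.toSubmonoid →* (V ≃ₗᵢ[ℝ] V)),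
    (Continuous fun p : G.toSubmonoid × V => ρ p.1 p.2) →
      ∃ φ : V →ₗᵢ[ℝ] RInf, ∀ (g : G.toSubmonoid) (v : V), φ (ρ g v) = (g : LMonoid) (φ v)

/-- Universal subgroups of `𝓛`. -/
structure UniversalSubgroup extends LSubgroup where
  isUniversal : toLSubgroup.IsUniversal

instance : CoeSort UniversalSubgroup Type := ⟨fun G => G.toSubmonoid⟩

instance (G : UniversalSubgroup) : IsTopologicalGroup G := by
  obtain ⟨n, _, _⟩ := G.isUniversal.exists_lieGroup
  exact topologicalGroup_of_lieGroup (𝓡 n) ∞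

variable (H G : UniversalSubgroup)

/-! ### The space `map(H, G)` -/

/-- `map(H, G)`: continuous group homomorphisms with the compact-open topology. -/
abbrev HomSpace : Type := H →ₜ* G

variable {H G} in
/-- The conjugate `(α · g)(h) = g⁻¹ α(h) g`. -/
def HomSpace.conj (α : HomSpace H G) (g : G) : HomSpace H G where
  toFun h := g⁻¹ * α h * g
  map_one' := by simp
  map_mul' a b := by simp [mul_assoc]
  continuous_toFun := by fun_prop

/-- The right action of `G` on `map(H, G)` by conjugation. -/
instance : MulAction Gᵐᵒᵖ (HomSpace H G) where
  smul g α := α.conj g.unop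
  one_smul α := by
    refine ContinuousMonoidHom.ext fun h => ?_
    change (1 : G)⁻¹ * α h * 1 = α h
    simp
  mul_smul a b α := by
    refine ContinuousMonoidHom.ext fun h => ?_
    change (b.unop * a.unop)⁻¹ * α h * (b.unop * a.unop) =
      a.unop⁻¹ * (b.unop⁻¹ * α h * b.unop) * a.unop
    simp only [mul_inv_rev, mul_assoc]

/-- `Rep(H, G) = map(H, G) / G`. -/
abbrev Rep : Type := MulAction.orbitRel.Quotient Gᵐᵒᵖ (HomSpace H G)

variable {H G} in
/-- The centralizer `C(α)` of the image of `α`. -/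
abbrev cent (α : HomSpace H G) : Subgroup G := Subgroup.centralizer (Set.range α)

/-! ### The space `E(H, G)` -/

/-- `E(H, G)`: the space `𝓛`, to be equipped with a right action of `H × G`. -/
def E (_H _G : UniversalSubgroup) : Type := LMonoid

variable {H G} in
/-- The element of `𝓛` underlying a point of `E(H, G)`. -/
def E.toL (f : E H G) : LMonoid := f

instance : TopologicalSpace (E H G) := inferInstanceAs (TopologicalSpace LMonoid)

/-- The right action of `H × G` on `E(H, G)`, given by `f · (h, g) = h⁻¹ ∘ f ∘ g`. -/
instance : MulAction (H × G)ᵐᵒᵖ (E H G) where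
  smul p f := ((p.unop.1⁻¹ : H) : LMonoid) * f.toL * ((p.unop.2 : G) : LMonoid)
  one_smul f := by
    change (((1 : H)⁻¹ : H) : LMonoid) * f.toL * ((1 : G) : LMonoid) = f.toL
    simp
  mul_smul a b f := by
    change (((b.unop.1 * a.unop.1)⁻¹ : H) : LMonoid) * f.toL *
        ((b.unop.2 * a.unop.2 : G) : LMonoid) =
      ((a.unop.1⁻¹ : H) : LMonoid) *
        (((b.unop.1⁻¹ : H) : LMonoid) * f.toL * ((b.unop.2 : G) : LMonoid)) *
        ((a.unop.2 : G) : LMonoid)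
    simp only [mul_inv_rev, Submonoid.coe_mul, mul_assoc]

variable {H G} in
/-- The right action of `H × G` on `E(H, G)`, written on the right. -/
def E.act (f : E H G) (h : H) (g : G) : E H G := op (h, g) • f

section act

variable {H G}

theorem E.act_act (f : E H G) (h h' : H) (g g' : G) :
    (f.act h g).act h' g' = f.act (h * h') (g * g') :=
  (mul_smul (op (h', g')) (op (h, g)) f).symm

theorem E.act_one (f : E H G) : f.act 1 1 = f := one_smul (H × G)ᵐᵒᵖ f

end act

/-- The right action of `G` on `E(H, G)`, the restriction of the action of `H × G`. -/
instance : MulAction Gᵐᵒᵖ (E H G) where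
  smul g f := f.act 1 g.unop
  one_smul f := f.act_one
  mul_smul a b f := by
    change f.act 1 (b.unop * a.unop) = (f.act 1 b.unop).act 1 a.unop
    rw [E.act_act, one_mul]

/-- The orbit space `E(H, G) / G`. -/
abbrev EModG : Type := MulAction.orbitRel.Quotient Gᵐᵒᵖ (E H G)

/-- The right action of `H` on `E(H, G) / G`, given by `[f] · h = [f · (h, 1)]`. -/
instance : MulAction Hᵐᵒᵖ (EModG H G) where
  smul h := Quotient.map (fun f => f.act h.unop 1) (by
    rintro _ f ⟨g, rfl⟩
    refine ⟨g, ?_⟩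
    change (f.act h.unop 1).act 1 g.unop = (f.act 1 g.unop).act h.unop 1
    simp [E.act_act])
  one_smul q := by
    induction q using Quotient.inductionOn with
    | _ f => exact congrArg _ f.act_one
  mul_smul a b q := by
    induction q using Quotient.inductionOn with
    | _ f =>
      refine congrArg (Quotient.mk _) ?_
      change f.act (b.unop * a.unop) 1 = (f.act b.unop 1).act a.unop 1
      rw [E.act_act, one_mul]

/-- `O_gl(H, G) = (E(H, G) / G) ^ H`, as a subspace of `E(H, G) / G`. -/
abbrev OGl : Type := MulAction.fixedPoints Hᵐᵒᵖ (EModG H G)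

variable {H G} in
/-- `E(H, G) ^ α`, the points of `E(H, G)` fixed by all `(h, α h)` in the graph of `α`. -/
def fixedBy (α : HomSpace H G) : Set (E H G) := {x | ∀ h : H, op (h, α h) • x = x}

variable {H G} in
/-- The right action of `C(α)` on `E(H, G) ^ α`, the restriction of the action of `G`. -/
instance (α : HomSpace H G) : MulAction (cent α)ᵐᵒᵖ (fixedBy α) where
  smul c x := ⟨op (c.unop : G) • (x : E H G), fun h => by
    change ((x : E H G).act 1 c.unop).act h (α h) = (x : E H G).act 1 c.unop
    have hc : (c.unop : G) * α h = α h * c.unop :=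
      (Subgroup.mem_centralizer_iff.1 c.unop.2 (α h) ⟨h, rfl⟩).symm
    have hx : (x : E H G).act h (α h) = x := x.2 h
    conv_rhs => rw [← hx]
    simp [E.act_act, hc]⟩
  one_smul x := Subtype.ext (one_smul Gᵐᵒᵖ (x : E H G))
  mul_smul a b x := Subtype.ext (mul_smul (op (a.unop : G)) (op (b.unop : G)) (x : E H G))

/-- The orbit space `E(H, G) ^ α / C(α)`. -/
abbrev FixedModCent {H G : UniversalSubgroup} (α : HomSpace H G) : Type :=
  MulAction.orbitRel.Quotient (cent α)ᵐᵒᵖ (fixedBy α)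

/-! ### The space `Ẽ(H, G)` -/

/-- `Ẽ(H, G)`: pairs `(α, x)` with `x ∈ E(H, G) ^ α`, as a subspace of `map(H, G) × E(H, G)`. -/
abbrev ETilde : Type := {p : HomSpace H G × E H G // p.2 ∈ fixedBy p.1}

/-- The diagonal right action of `G` on `Ẽ(H, G)`: `(α, x) · g = (α · g, x · g)`. -/
instance : MulAction Gᵐᵒᵖ (ETilde H G) where
  smul g p := ⟨(g • p.1.1, g • p.1.2), fun h => by
    change (p.1.2.act 1 g.unop).act h (g.unop⁻¹ * p.1.1 h * g.unop) = p.1.2.act 1 g.unop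
    have hx : p.1.2.act h (p.1.1 h) = p.1.2 := p.2 h
    conv_rhs => rw [← hx]
    simp [E.act_act, ← mul_assoc]⟩
  one_smul p := Subtype.ext (Prod.ext (one_smul _ _) (one_smul _ _))
  mul_smul a b p := Subtype.ext (Prod.ext (mul_smul _ _ _) (mul_smul _ _ _))

/-- The orbit space `Ẽ(H, G) / G`. -/
abbrev ETildeModG : Type := MulAction.orbitRel.Quotient Gᵐᵒᵖ (ETilde H G)

end

end OrbiGl

/-!
A point `x` of `E(H, G)` whose `G`-orbit is fixed by `H` satisfies `x · (h, α h) = x` for a unique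
homomorphism `α`, because isometries are injective, so `G` acts freely. Hence `[α, x] ↦ [x]` is
bijective, and it is a homeomorphism once `α` depends continuously on `x`. The action of the compact
group `G` on `𝓛` is jointly continuous, which is reduced to compact families of isometries; these
are described in elementary terms by `continuous_iff_eval`, since a compact subset of
`colim_W L(U, W)` lies in a finite stage. By `continuous_translation` the graph of
`(x, h) ↦ α h` is then closed, so that this map is continuous, and so is the adjoint
`x ↦ α ∈ map(H, G)`.

The decomposition of `Ẽ(H, G) / G` into the pieces `E(H, G) ^ α / C(α)` is a bijection for formal
reasons. It is open because homomorphisms close to `α` are conjugate to `α` by elements of `G` close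
to `1` (`eventually_exists_conj`). To see this, let `G` act faithfully by orthogonal matrices: this
is possible on a finite-dimensional invariant subspace of `ℝ^∞`, as `ℝ^∞` is the union of such
subspaces and `G`, being a Lie group, has no small subgroups
(`exists_nhds_one_subgroup_eq_bot`). For `β` close to `α`, the average `T` of the matrices
`α h * (β h)⁻¹` is close to `1` and intertwines `β` with `α`, and so does the point of `G` nearest
to `T` in the Frobenius norm, provided that it is unique. Uniqueness is local, and follows from the
existence of square roots near the identity of `G` (`map_sq_nhds_one`,
`eq_zero_of_norm_sub_sq`): the square root of the quotient of two nearest points would give a point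
of `G` that is strictly closer to `T`.
-/

namespace OrbiGl

noncomputable section

open MulOpposite Filter Topology
open scoped Manifold ContDiff

/-! ### Continuous families of linear isometries -/

/-- The `i`-th coordinate as a linear functional on `ℝ^∞`. -/
def RInf.coord (i : ℕ) : RInf →ₗ[ℝ] ℝ := Finsupp.lapply (M := ℝ) i

theorem RInf.exists_coord_eq_zero (x : RInf) : ∃ N, ∀ i ≥ N, RInf.coord i x = 0 := by
  obtain ⟨N, hN⟩ := (Finsupp.support (show ℕ →₀ ℝ from x)).exists_nat_subset_range
  refine ⟨N, fun i hi => ?_⟩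
  by_contra h
  have : i ∈ Finsupp.support (show ℕ →₀ ℝ from x) := Finsupp.mem_support_iff.2 h
  have := Finset.mem_range.1 (hN this)
  omega

/-- The subspace `ℝ^N` of `ℝ^∞`. -/
def RInf.stage (N : ℕ) : Submodule ℝ RInf := ⨅ i ≥ N, LinearMap.ker (RInf.coord i)

theorem RInf.mem_stage {N : ℕ} {x : RInf} :
    x ∈ RInf.stage N ↔ ∀ i ≥ N, RInf.coord i x = 0 := by
  simp [RInf.stage]

theorem RInf.stage_mono : Monotone RInf.stage := fun _ _ h _ hx =>
  RInf.mem_stage.2 fun i hi => RInf.mem_stage.1 hx i (h.trans hi)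

instance RInf.finiteDimensional_stage (N : ℕ) : FiniteDimensional ℝ (RInf.stage N) := by
  let T : RInf.stage N →ₗ[ℝ] (Fin N → ℝ) :=
    LinearMap.pi fun i => (RInf.coord i).comp (RInf.stage N).subtype
  refine FiniteDimensional.of_injective T fun x y hxy => Subtype.ext (Finsupp.ext fun i => ?_)
  by_cases hi : i < N
  · exact congrFun hxy ⟨i, hi⟩
  · exact (RInf.mem_stage.1 x.2 i (not_lt.1 hi)).trans (RInf.mem_stage.1 y.2 i (not_lt.1 hi)).symm

theorem RInf.exists_mem_stage (x : RInf) : ∃ N, x ∈ RInf.stage N :=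
  (RInf.exists_coord_eq_zero x).imp fun _ h => RInf.mem_stage.2 h

theorem RInf.exists_le_stage (W : Submodule ℝ RInf) [FiniteDimensional ℝ W] :
    ∃ N, W ≤ RInf.stage N := by
  obtain ⟨s, hs⟩ := (Submodule.fg_iff_finiteDimensional W).2 inferInstance
  choose n hn using RInf.exists_mem_stage
  refine ⟨s.sup n, ?_⟩
  rw [← hs, Submodule.span_le]
  exact fun x hx => RInf.stage_mono (Finset.le_sup hx) (hn x)

section colim

variable {U : Type} [NormedAddCommGroup U] [InnerProductSpace ℝ U]

theorem continuous_eval_stiefelTopology (W : Type) [NormedAddCommGroup W] [InnerProductSpace ℝ W]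
    (u : U) : Continuous[stiefelTopology U W, inferInstance] (fun f : U →ₗᵢ[ℝ] W => f u) := by
  let _ := stiefelTopology U W
  exact (continuous_apply u).comp continuous_induced_dom

theorem continuous_eval_colimTopology (u : U) :
    Continuous[colimTopology U RInf, inferInstance] (fun f : U →ₗᵢ[ℝ] RInf => f u) := by
  simp only [continuous_iSup_dom, continuous_coinduced_dom]
  intro W _
  let _ := stiefelTopology U W
  exact continuous_subtype_val.comp (continuous_eval_stiefelTopology W u)

/-- A compact family in `colim_W L(U, W)` moves any given vector within a finite-dimensional
subspace: otherwise it contains a sequence that leaves every stage, and the tails of such a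
sequence are closed sets with the finite intersection property but without common point. -/
theorem exists_eval_mem_stage {S : Type} [TopologicalSpace S] [CompactSpace S]
    {f : S → U →ₗᵢ[ℝ] RInf} (hf : Continuous[inferInstance, colimTopology U RInf] f) (u : U) :
    ∃ N, ∀ s, f s u ∈ RInf.stage N := by
  by_contra! h
  choose s hs using h
  let A : ℕ → Set (U →ₗᵢ[ℝ] RInf) := fun n => {g | ∃ m ≥ n, f (s m) = g}
  have hA : ∀ n, IsClosed[colimTopology U RInf] (A n) := fun n => by
    simp only [isClosed_iSup_iff, isClosed_coinduced]
    intro W _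
    let _ := stiefelTopology U W
    obtain ⟨N, hN⟩ := RInf.exists_le_stage W
    have : T1Space (U →ₗᵢ[ℝ] W) :=
      t1Space_of_injective_of_continuous (f := fun f v => f v) DFunLike.coe_injective
        continuous_induced_dom
    refine (Set.Finite.preimage (f := fun g : U →ₗᵢ[ℝ] W => W.subtypeₗᵢ.comp g)
      (fun a _ b _ hab => LinearIsometry.ext fun v => Subtype.ext (DFunLike.congr_fun hab v))
      ((Set.finite_lt_nat N).image fun m => f (s m))).subset ?_ |>.isClosed
    rintro g ⟨m, -, hm⟩
    refine ⟨m, ?_, hm⟩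
    by_contra hNm
    refine hs m (RInf.stage_mono (not_lt.1 hNm) (hN ?_))
    rw [hm]
    exact (g u).2
  let _ := colimTopology U RInf
  obtain ⟨t, ht⟩ := IsCompact.nonempty_iInter_of_sequence_nonempty_isCompact_isClosed
    (fun n => f ⁻¹' A n) (fun n t ⟨m, hm, h⟩ => ⟨m, by omega, h⟩)
    (fun n => ⟨s n, n, le_rfl, rfl⟩) ((hA 0).preimage hf).isCompact
    (fun n => (hA n).preimage hf)
  obtain ⟨N, hN⟩ := RInf.exists_mem_stage (f t u)
  obtain ⟨m, hm, h⟩ := Set.mem_iInter.1 ht N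
  exact hs m (RInf.stage_mono hm (h ▸ hN))

end colim

theorem isomTopology_le_limTopology : isomTopology RInf RInf ≤ limTopology RInf RInf := by
  let _ := limTopology RInf RInf
  exact continuous_id_iff_le.1 (continuous_from_compactlyGenerated _ fun S g => g.2)

theorem continuous_of_continuous_limTopology {S : Type} [TopologicalSpace S] [CompactSpace S]
    [T2Space S] {f : S → LMonoid} (hf : Continuous[_, limTopology RInf RInf] f) :
    Continuous f := by
  let _ := limTopology RInf RInf
  rw [continuous_def]
  intro O hO
  let K : (S : CompHaus) × C(S, RInf →ₗᵢ[ℝ] RInf) := ⟨CompHaus.of S, ⟨f, hf⟩⟩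
  exact (isOpen_coinduced.1 hO).preimage
    (continuous_sigmaMk (σ := fun i : (S : CompHaus) × C(S, RInf →ₗᵢ[ℝ] RInf) => i.1) (i := K))

/-- A family of isometries that moves every vector within a finite-dimensional subspace does so
for all vectors of a finite-dimensional subspace at once. -/
theorem exists_maps_to_stage {S : Type} {f : S → LMonoid}
    (h : ∀ u, ∃ N, ∀ s, f s u ∈ RInf.stage N) (U : Submodule ℝ RInf) [FiniteDimensional ℝ U] :
    ∃ N, ∀ s, ∀ u ∈ U, f s u ∈ RInf.stage N := by
  choose n hn using h
  obtain ⟨b, hb⟩ := (Submodule.fg_iff_finiteDimensional U).2 inferInstance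
  refine ⟨b.sup n, fun t u hu => ?_⟩
  have : U ≤ (RInf.stage (b.sup n)).comap (f t).toLinearMap := by
    rw [← hb, Submodule.span_le]
    exact fun v hv => RInf.stage_mono (Finset.le_sup hv) (hn v t)
  exact this hu

/-- Continuity of a map from a compact Hausdorff space into `𝓛`, in elementary terms: it is
pointwise continuous in norm, and each vector moves within a finite-dimensional subspace. -/
theorem continuous_iff_eval {S : Type} [TopologicalSpace S] [CompactSpace S] [T2Space S]
    {f : S → LMonoid} :
    Continuous f ↔ ∀ u, Continuous (fun s => f s u) ∧ ∃ N, ∀ s, f s u ∈ RInf.stage N := by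
  constructor
  · intro hf u
    let U : Submodule ℝ RInf := Submodule.span ℝ {u}
    let u' : U := ⟨u, Submodule.mem_span_singleton_self u⟩
    have hlim : Continuous[_, limTopology RInf RInf] f := by
      exact continuous_le_rng isomTopology_le_limTopology hf
    have hU : Continuous[_, colimTopology U RInf] fun s => (f s).comp U.subtypeₗᵢ := by
      simp only [continuous_iInf_rng, continuous_induced_rng] at hlim
      exact hlim U inferInstance
    refine ⟨?_, exists_eval_mem_stage hU u'⟩
    let _ := colimTopology U RInf
    exact (continuous_eval_colimTopology u').comp hU
  · intro h
    have hlim : Continuous[_, limTopology RInf RInf] f := by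
      simp only [continuous_iInf_rng, continuous_induced_rng]
      intro U _
      obtain ⟨N, hW⟩ := exists_maps_to_stage (fun u => (h u).2) U
      let W := RInf.stage N
      let g : S → U →ₗᵢ[ℝ] W := fun t =>
        { toLinearMap := ((f t).toLinearMap.comp U.subtype).codRestrict W fun u => hW t u u.2
          norm_map' := fun u => (f t).norm_map u }
      have hg : Continuous[_, stiefelTopology U W] g := by
        refine continuous_induced_rng.2 (continuous_pi fun u => ?_)
        exact continuous_induced_rng.2 (h u).1
      let _ := stiefelTopology U W
      let _ := colimTopology U RInf
      have hWc : Continuous fun f : U →ₗᵢ[ℝ] W => W.subtypeₗᵢ.comp f := by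
        rw [continuous_iff_coinduced_le]
        exact le_iSup₂_of_le W inferInstance le_rfl
      exact hWc.comp hg
    exact continuous_of_continuous_limTopology hlim

/-- Maps out of `𝓛` are continuous if they are continuous along compact Hausdorff families. -/
theorem continuous_of_comp_compact {Y : Type*} [TopologicalSpace Y] {F : LMonoid → Y}
    (h : ∀ (S : Type) [TopologicalSpace S] [CompactSpace S] [T2Space S] (c : S → LMonoid),
      Continuous c → Continuous (F ∘ c)) : Continuous F := by
  let _ := limTopology RInf RInf
  exact continuous_from_compactlyGenerated _ fun S g =>
    h S g (continuous_of_continuous_limTopology g.2)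

theorem continuous_eval (u : RInf) : Continuous fun f : LMonoid => f u :=
  continuous_of_comp_compact fun _ _ _ _ _ hc => (continuous_iff_eval.1 hc u).1

instance : T2Space LMonoid :=
  T2Space.of_injective_continuous (f := fun (f : LMonoid) u => f u) DFunLike.coe_injective
    (continuous_pi continuous_eval)

/-- Composition of two compact families of isometries is jointly continuous. -/
theorem continuous_comp_compact {S K : Type} [TopologicalSpace S] [CompactSpace S] [T2Space S]
    [TopologicalSpace K] [CompactSpace K] [T2Space K] {c : S → LMonoid} {d : K → LMonoid}
    (hc : Continuous c) (hd : Continuous d) : Continuous fun p : S × K => c p.1 * d p.2 := by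
  rw [continuous_iff_eval] at hc hd ⊢
  intro u
  constructor
  · refine continuous_iff_continuousAt.2 fun ⟨s₀, k₀⟩ => tendsto_iff_dist_tendsto_zero.2 ?_
    have h1 : Tendsto (fun p : S × K => dist (d p.2 u) (d k₀ u)) (𝓝 (s₀, k₀)) (𝓝 0) :=
      tendsto_iff_dist_tendsto_zero.1 (((hd u).1.comp continuous_snd).tendsto (s₀, k₀))
    have h2 : Tendsto (fun p : S × K => dist (c p.1 (d k₀ u)) (c s₀ (d k₀ u)))
        (𝓝 (s₀, k₀)) (𝓝 0) :=
      tendsto_iff_dist_tendsto_zero.1 (((hc (d k₀ u)).1.comp continuous_fst).tendsto (s₀, k₀))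
    refine squeeze_zero (fun _ => dist_nonneg) (fun p => ?_) (by simpa using h1.add h2)
    refine (dist_triangle _ (c p.1 (d k₀ u)) _).trans (add_le_add_left (le_of_eq ?_) _)
    exact (c p.1).dist_map _ _
  · obtain ⟨N, hN⟩ := (hd u).2
    obtain ⟨M, hM⟩ := exists_maps_to_stage (fun v => (hc v).2) (RInf.stage N)
    exact ⟨M, fun p => hM p.1 _ (hN p.2)⟩

/-- Joint continuity on `𝓛 × K` for compact `K` can be tested along compact families in `𝓛`. -/
theorem continuous_prod_of_comp_compact {K Y : Type} [TopologicalSpace K] [CompactSpace K]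
    [T2Space K] [TopologicalSpace Y] {F : LMonoid × K → Y}
    (h : ∀ (S : Type) [TopologicalSpace S] [CompactSpace S] [T2Space S] (c : S → LMonoid),
      Continuous c → Continuous fun p : S × K => F (c p.1, p.2)) : Continuous F := by
  have hk : ∀ f, Continuous fun k => F (f, k) := fun f =>
    (h Unit (fun _ => f) continuous_const).comp (Continuous.prodMk_right ())
  let Φ : LMonoid → C(K, Y) := fun f => ⟨fun k => F (f, k), hk f⟩
  have hΦ : Continuous Φ := continuous_of_comp_compact fun S _ _ _ c hc =>
    ContinuousMap.continuous_of_continuous_uncurry _ (h S c hc)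
  exact ContinuousMap.continuous_uncurry_of_continuous ⟨Φ, hΦ⟩

theorem continuous_mul_compact {K : Type} [TopologicalSpace K] [CompactSpace K]
    [T2Space K] {d : K → LMonoid} (hd : Continuous d) :
    Continuous fun p : LMonoid × K => p.1 * d p.2 :=
  continuous_prod_of_comp_compact fun _ _ _ _ _ hc => continuous_comp_compact hc hd

theorem continuous_compact_mul {K : Type} [TopologicalSpace K] [CompactSpace K]
    [T2Space K] {d : K → LMonoid} (hd : Continuous d) :
    Continuous fun p : LMonoid × K => d p.2 * p.1 :=
  continuous_prod_of_comp_compact fun _ _ _ _ _ hc =>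
    (continuous_comp_compact hd hc).comp continuous_swap

/-! ### Squaring in a Lie group near the identity -/

section LieGroup

variable {n : ℕ} {G : Type} [TopologicalSpace G] [Group G]
  [ChartedSpace (EuclideanSpace ℝ (Fin n)) G] [LieGroup (𝓡 n) ∞ G]

/-- In a chart around the identity, squaring is strictly differentiable with derivative `2`. -/
theorem hasStrictFDerivAt_sq_chart :
    let φ := chartAt (EuclideanSpace ℝ (Fin n)) (1 : G)
    HasStrictFDerivAt (fun x => φ (φ.symm x * φ.symm x))
      ((2 : ℝ) • ContinuousLinearMap.id ℝ (EuclideanSpace ℝ (Fin n))) (φ 1) := by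
  intro φ
  let F := EuclideanSpace ℝ (Fin n)
  have h1 : (1 : G) ∈ φ.source := mem_chart_source _ _
  have hx : φ 1 ∈ φ.target := φ.map_source h1
  have hs : φ.symm (φ 1) = 1 := φ.left_inv h1
  let M : F × F → F := fun p => φ (φ.symm p.1 * φ.symm p.2)
  have hφs : ContMDiffAt (𝓡 n) (𝓡 n) ∞ φ.symm (φ 1) :=
    contMDiffOn_chart_symm.contMDiffAt (φ.open_target.mem_nhds hx)
  have hφ : ContMDiffAt (𝓡 n) (𝓡 n) ∞ φ 1 :=
    contMDiffOn_chart.contMDiffAt (φ.open_source.mem_nhds h1)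
  have hM : ContMDiffAt 𝓘(ℝ, F × F) 𝓘(ℝ, F) ∞ M (φ 1, φ 1) := by
    have ha : ContMDiffAt 𝓘(ℝ, F × F) (𝓡 n) ∞ (fun p : F × F => φ.symm p.1) (φ 1, φ 1) :=
      ContMDiffAt.comp (I' := 𝓡 n) (φ 1, φ 1) hφs contDiffAt_fst.contMDiffAt
    have hb : ContMDiffAt 𝓘(ℝ, F × F) (𝓡 n) ∞ (fun p : F × F => φ.symm p.2) (φ 1, φ 1) :=
      ContMDiffAt.comp (I' := 𝓡 n) (φ 1, φ 1) hφs contDiffAt_snd.contMDiffAt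
    refine ContMDiffAt.comp (I' := 𝓡 n) (φ 1, φ 1) ?_ (ha.mul hb)
    simpa [hs] using hφ
  have hD := hM.contDiffAt.hasStrictFDerivAt (by simp)
  set D := fderiv ℝ M (φ 1, φ 1)
  have e1 : ∀ v, D (v, 0) = v := by
    have h := HasFDerivAt.comp (f := fun x => (x, φ 1)) (φ 1) hD.hasFDerivAt
      (hasFDerivAt_prodMk_left (𝕜 := ℝ) (φ 1) (φ 1))
    have h' : HasFDerivAt (M ∘ fun x => (x, φ 1)) (ContinuousLinearMap.id ℝ F) (φ 1) := by
      refine (hasFDerivAt_id (φ 1)).congr_of_eventuallyEq ?_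
      filter_upwards [φ.open_target.mem_nhds hx] with x hx
      simp [M, hs, φ.right_inv hx]
    exact fun v => DFunLike.congr_fun (h.unique h') v
  have e2 : ∀ v, D (0, v) = v := by
    have h := HasFDerivAt.comp (f := fun x => (φ 1, x)) (φ 1) hD.hasFDerivAt
      (hasFDerivAt_prodMk_right (𝕜 := ℝ) (φ 1) (φ 1))
    have h' : HasFDerivAt (M ∘ fun x => (φ 1, x)) (ContinuousLinearMap.id ℝ F) (φ 1) := by
      refine (hasFDerivAt_id (φ 1)).congr_of_eventuallyEq ?_
      filter_upwards [φ.open_target.mem_nhds hx] with x hx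
      simp [M, hs, φ.right_inv hx]
    exact fun v => DFunLike.congr_fun (h.unique h') v
  have h := HasStrictFDerivAt.comp (f := fun x => (x, x)) (φ 1) hD
    ((hasStrictFDerivAt_id (φ 1)).prodMk (hasStrictFDerivAt_id (φ 1)))
  refine h.congr_fderiv (ContinuousLinearMap.ext fun v => ?_)
  have : ((v, v) : F × F) = (v, 0) + (0, v) := by simp
  change D (v, v) = (2 : ℝ) • v
  rw [this, map_add, e1, e2, two_smul]

/-- In a Lie group, squaring is open at the identity; in particular, all elements near the identity
have square roots near the identity. -/
theorem map_sq_nhds_one (n : ℕ) (G : Type) [TopologicalSpace G] [Group G]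
    [ChartedSpace (EuclideanSpace ℝ (Fin n)) G] [LieGroup (𝓡 n) ∞ G] :
    map (fun g : G => g * g) (𝓝 1) = 𝓝 1 := by
  have := topologicalGroup_of_lieGroup (𝓡 n) ∞ (G := G)
  let φ := chartAt (EuclideanSpace ℝ (Fin n)) (1 : G)
  have h1 : (1 : G) ∈ φ.source := mem_chart_source _ _
  have hs : φ.symm (φ 1) = 1 := φ.left_inv h1
  have hmap := (hasStrictFDerivAt_sq_chart (n := n) (G := G)).map_nhds_eq_of_surj
    (LinearMap.range_eq_top.2 fun v => ⟨(2 : ℝ)⁻¹ • v, by simp⟩)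
  change map (fun x => φ (φ.symm x * φ.symm x)) (𝓝 (φ 1)) = 𝓝 (φ (φ.symm (φ 1) * φ.symm (φ 1)))
    at hmap
  rw [hs, mul_one] at hmap
  have hsymm : map φ.symm (𝓝 (φ 1)) = 𝓝 1 := by
    rw [φ.symm.map_nhds_eq (φ.map_source h1), hs]
  have hsq : (fun g => φ.symm (φ (φ.symm (φ g) * φ.symm (φ g)))) =ᶠ[𝓝 1] fun g : G => g * g := by
    have hc : Tendsto (fun g : G => g * g) (𝓝 1) (𝓝 1) := by
      simpa using (show Continuous fun g : G => g * g by fun_prop).tendsto 1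
    filter_upwards [φ.open_source.mem_nhds h1, hc (φ.open_source.mem_nhds h1)] with g hg hgg
    rw [φ.left_inv hg]
    exact φ.left_inv hgg
  conv_rhs => rw [← hsymm, ← hmap, ← φ.map_nhds_eq h1, map_map, map_map]
  exact (map_congr hsq).symm

/-- A Lie group has no small subgroups: in a chart, squaring almost doubles the distance to the
identity, so no nontrivial cyclic subgroup stays in a small ball. -/
theorem exists_nhds_one_subgroup_eq_bot (n : ℕ) (G : Type) [TopologicalSpace G] [Group G]
    [ChartedSpace (EuclideanSpace ℝ (Fin n)) G] [LieGroup (𝓡 n) ∞ G] :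
    ∃ U ∈ 𝓝 (1 : G), ∀ K : Subgroup G, (K : Set G) ⊆ U → K = ⊥ := by
  let φ := chartAt (EuclideanSpace ℝ (Fin n)) (1 : G)
  have h1 : (1 : G) ∈ φ.source := mem_chart_source _ _
  have hs : φ.symm (φ 1) = 1 := φ.left_inv h1
  have h := (hasStrictFDerivAt_sq_chart (n := n) (G := G)).hasFDerivAt.isLittleO.def
    (c := 1 / 2) (by norm_num)
  obtain ⟨r, hr, hball⟩ := Metric.eventually_nhds_iff_ball.1 h
  refine ⟨φ.source ∩ φ ⁻¹' Metric.ball (φ 1) r,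
    φ.continuousAt h1 |>.preimage_mem_nhds (Metric.ball_mem_nhds _ hr) |>
      inter_mem (φ.open_source.mem_nhds h1), fun K hK => ?_⟩
  have hstep : ∀ g ∈ K, 3 / 2 * ‖φ g - φ 1‖ ≤ ‖φ (g * g) - φ 1‖ := by
    intro g hg
    have := hball (φ g) (hK hg).2
    change ‖φ (φ.symm (φ g) * φ.symm (φ g)) - φ (φ.symm (φ 1) * φ.symm (φ 1)) -
      (2 : ℝ) • (φ g - φ 1)‖ ≤ _ at this
    rw [hs, mul_one, φ.left_inv (hK hg).1] at this
    have h2 : ‖(2 : ℝ) • (φ g - φ 1)‖ = 2 * ‖φ g - φ 1‖ := by simp [norm_smul]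
    have h3 := norm_sub_norm_le ((2 : ℝ) • (φ g - φ 1)) (φ (g * g) - φ 1)
    rw [norm_sub_rev ((2 : ℝ) • (φ g - φ 1))] at h3
    change _ ≤ 1 / 2 * ‖φ g - φ 1‖ at this
    linarith
  have hpow : ∀ (k : ℕ), ∀ g ∈ K, (3 / 2) ^ k * ‖φ g - φ 1‖ < r := by
    intro k
    induction k with
    | zero =>
      intro g hg
      simpa using mem_ball_iff_norm.1 (hK hg).2
    | succ k ih =>
      intro g hg
      refine lt_of_le_of_lt ?_ (ih (g * g) (K.mul_mem hg hg))
      rw [pow_succ, mul_assoc]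
      exact mul_le_mul_of_nonneg_left (hstep g hg) (by positivity)
  refine (Subgroup.eq_bot_iff_forall K).2 fun g hg => ?_
  by_contra hne
  have hpos : 0 < ‖φ g - φ 1‖ := norm_pos_iff.2 (sub_ne_zero.2 fun h =>
    hne (φ.injOn (hK hg).1 h1 h))
  obtain ⟨k, hk⟩ := pow_unbounded_of_one_lt (r / ‖φ g - φ 1‖) (by norm_num : (1 : ℝ) < 3 / 2)
  exact (hpow k g hg).not_gt ((div_lt_iff₀ hpos).1 hk)

end LieGroup

/-! ### Nearby homomorphisms are conjugate -/

section conj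

open MeasureTheory

variable {A : Type*} [NormedRing A] [InnerProductSpace ℝ A]

/-- The midpoint argument for uniqueness of nearest points. If `1 + a = (1 + b) ^ 2` and both `1`
and `1 + a` are nearest to `1 + t` among `1, 1 + b, 1 + a`, then `a = 0`: the linear functional
`⟪t, ·⟫` is `‖a‖ ^ 2 / 2` at `a ≈ 2 b`, hence almost `‖b‖ ^ 2` at `b`, but it is at most
`‖b‖ ^ 2 / 2` there. -/
theorem eq_zero_of_norm_sub_sq {t a b : A} (hab : a = 2 * b + b * b) (hb : ‖b‖ ≤ 1 / 3)
    (ht : ‖t‖ ≤ 1 / 3) (ha : ‖t - a‖ = ‖t‖) (hle : ‖t‖ ≤ ‖t - b‖) : a = 0 := by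
  have h1 := norm_sub_sq_real t a
  have h2 := norm_sub_sq_real t b
  have hab' : a = (2 : ℝ) • b + b * b := by rw [hab, two_smul, two_mul]
  have h3 : inner ℝ t a = 2 * inner ℝ t b + inner ℝ t (b * b) := by
    rw [hab', inner_add_right, inner_smul_right]
  have h4 : inner ℝ t (b * b) ≤ ‖t‖ * ‖b * b‖ := real_inner_le_norm _ _
  have h5 : ‖b * b‖ ≤ ‖b‖ * ‖b‖ := norm_mul_le _ _
  have h6 : (5 / 3) * ‖b‖ ≤ ‖a‖ := by
    have := norm_sub_le_norm_add ((2 : ℝ) • b) (b * b)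
    rw [← hab', norm_smul] at this
    norm_num at this
    nlinarith [norm_nonneg b]
  have h7 : ‖t‖ ^ 2 ≤ ‖t - b‖ ^ 2 := by gcongr
  have h8 : ‖t‖ * ‖b * b‖ ≤ 1 / 3 * (‖b‖ * ‖b‖) := by gcongr
  have h9 : (5 / 3 * ‖b‖) ^ 2 ≤ ‖a‖ ^ 2 := by gcongr
  rw [ha] at h1
  have h10 : ‖b‖ = 0 := by nlinarith [norm_nonneg b, sq_nonneg ‖b‖]
  rw [hab, norm_eq_zero.1 h10]
  simp

/-- Let `ρ` be a faithful continuous representation of a compact group `G` in a normed ring with a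
Hilbert space norm that is invariant under multiplication by `ρ g` on both sides. If squaring is
open at `1 ∈ G`, then homomorphisms into `G` that are close to `α` are conjugate to `α` by elements
of `G` close to `1`.

For `β` close to `α`, the average `T = ∫ ρ (α h * (β h)⁻¹)` is close to `1` and satisfies
`ρ (α h) * T = T * ρ (β h)`. There is a unique point `ρ g` of `ρ G` nearest to `T`, so by invariance
it satisfies the same equation. -/
theorem eventually_exists_conj [CompleteSpace A] {H G : Type*}
    [TopologicalSpace H] [Group H] [IsTopologicalGroup H] [CompactSpace H] [T2Space H]
    [TopologicalSpace G] [Group G] [IsTopologicalGroup G] [CompactSpace G]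
    (hsq : map (fun g : G => g * g) (𝓝 1) = 𝓝 1)
    (ρ : G →* A) (hρ : Continuous ρ) (hinj : Function.Injective ρ)
    (hl : ∀ g a, ‖ρ g * a‖ = ‖a‖) (hr : ∀ g a, ‖a * ρ g‖ = ‖a‖)
    (α : H →ₜ* G) {N : Set G} (hN : N ∈ 𝓝 1) :
    ∀ᶠ β : H →ₜ* G in 𝓝 α, ∃ g ∈ N, ∀ h, β h = g⁻¹ * α h * g := by
  -- Elements `g` with `ρ g` close to `1` lie in `N` and have a square root `k` with `ρ k` close
  -- to `1`.
  have hδ : ∃ δ > 0, ∀ g, ‖ρ g - 1‖ < δ → g ∈ N ∧ ∃ k, ‖ρ k - 1‖ ≤ 1 / 3 ∧ k * k = g := by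
    have hV : {k | ‖ρ k - 1‖ < 1 / 3} ∈ 𝓝 (1 : G) :=
      (isOpen_lt (by fun_prop) continuous_const).mem_nhds (by simp)
    have hW : N ∩ (fun g => g * g) '' {k | ‖ρ k - 1‖ < 1 / 3} ∈ 𝓝 (1 : G) :=
      inter_mem hN (hsq ▸ image_mem_map hV)
    obtain ⟨O, hOW, hO, h1O⟩ := mem_nhds_iff.1 hW
    -- On the compact complement of a neighbourhood of `1`, the distance of `ρ g` to `1` has a
    -- positive minimum.
    obtain hC | hC := (Oᶜ).eq_empty_or_nonempty
    · refine ⟨1, one_pos, fun g _ => ?_⟩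
      obtain ⟨hg, k, hk, hkg⟩ := hOW (Set.compl_empty_iff.1 hC ▸ Set.mem_univ g)
      exact ⟨hg, k, le_of_lt hk, hkg⟩
    · obtain ⟨g₀, hg₀, hmin⟩ := hO.isClosed_compl.isCompact.exists_isMinOn hC
        (f := fun g => ‖ρ g - 1‖) (by fun_prop)
      refine ⟨‖ρ g₀ - 1‖, norm_pos_iff.2 (sub_ne_zero.2 fun h => ?_), fun g hg => ?_⟩
      · rw [← map_one ρ] at h
        exact hg₀ (hinj h ▸ h1O)
      · have hgO : g ∈ O := by
          by_contra hgO
          exact (hmin hgO).not_gt hg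
        obtain ⟨hg, k, hk, hkg⟩ := hOW hgO
        exact ⟨hg, k, le_of_lt hk, hkg⟩
  obtain ⟨δ, hδ, hδN⟩ := hδ
  -- Two points within `ε` of a common point are less than `δ` apart, and `1 / 3` is the bound on
  -- `t` in `eq_zero_of_norm_sub_sq`.
  let ε := min (δ / 3) (1 / 3)
  have hε : 0 < ε := by positivity
  have hclose : ∀ᶠ β : H →ₜ* G in 𝓝 α, ∀ h, ‖ρ (α h * (β h)⁻¹) - 1‖ ≤ ε := by
    let O : Set G := {g | ‖ρ g - 1‖ < ε}
    have hO : IsOpen O := isOpen_lt (by fun_prop) continuous_const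
    let inv : C(G, G) := ⟨fun g => g⁻¹, continuous_inv⟩
    let D : (H →ₜ* G) → C(H, G) := fun β => α.toContinuousMap * inv.comp β.toContinuousMap
    have hD : Continuous D := continuous_const.mul ((ContinuousMap.continuous_postcomp inv).comp
      (ContinuousMonoidHom.isInducing_toContinuousMap H G).continuous)
    have hmem := ((ContinuousMap.isOpen_setOfPred_mapsTo isCompact_univ hO).preimage hD).mem_nhds
      (x := α) fun h _ => by
        change ‖ρ (α h * (α h)⁻¹) - 1‖ < ε
        simpa using hε
    filter_upwards [hmem] with β hβ h
    exact le_of_lt (hβ (Set.mem_univ h))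
  filter_upwards [hclose] with β hβ
  let _ : MeasurableSpace H := borel H
  have : BorelSpace H := ⟨rfl⟩
  let μ : Measure H := Measure.haarMeasure ⊤
  have hμ : μ Set.univ = 1 := Measure.haarMeasure_self
  have : IsProbabilityMeasure μ := ⟨hμ⟩
  let q : H → A := fun h => ρ (α h * (β h)⁻¹)
  have hq : Continuous q := hρ.comp (by fun_prop)
  have hint : Integrable q μ :=
    hq.integrable_of_hasCompactSupport (HasCompactSupport.of_compactSpace _)
  let T : A := ∫ h, q h ∂μ
  have hT : ‖T - 1‖ ≤ ε := by
    have : T - 1 = ∫ h, (q h - 1) ∂μ := by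
      rw [integral_sub hint (integrable_const _)]
      simp [T]
    rw [this]
    simpa only [probReal_univ, mul_one] using
      norm_integral_le_of_norm_le_const (μ := μ) (.of_forall hβ)
  have hTα : ∀ k, ρ (α k) * T * ρ (β k)⁻¹ = T := by
    intro k
    let Λ : A →+ A := (AddMonoidHom.mulRight (ρ (β k)⁻¹)).comp (AddMonoidHom.mulLeft (ρ (α k)))
    let L : A →L[ℝ] A := Λ.toRealLinearMap
      (by change Continuous fun a => ρ (α k) * a * ρ (β k)⁻¹; fun_prop)
    calc L T = ∫ h, L (q h) ∂μ := (L.integral_comp_comm hint).symm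
      _ = ∫ h, q (k * h) ∂μ := by
        refine integral_congr_ae (.of_forall fun h => ?_)
        change ρ (α k) * ρ (α h * (β h)⁻¹) * ρ (β k)⁻¹ = ρ (α (k * h) * (β (k * h))⁻¹)
        simp only [← map_mul ρ, map_mul α, map_mul β, mul_inv_rev, mul_assoc]
      _ = T := integral_mul_left_eq_self q k
  obtain ⟨g, -, hg⟩ := isCompact_univ.exists_isMinOn Set.univ_nonempty
    (f := fun g => ‖T - ρ g‖) (by fun_prop)
  have hmin : ∀ g', ‖T - ρ g‖ ≤ ‖T - ρ g'‖ := fun g' => hg (Set.mem_univ g')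
  have hTg : ‖T - ρ g‖ ≤ ε := (hmin 1).trans (by rwa [map_one])
  have huniq : ∀ g', ‖T - ρ g'‖ = ‖T - ρ g‖ → g' = g := by
    intro g' hg'
    -- Translation by `g⁻¹` moves the nearest points `g` and `g'` to `1` and `g⁻¹ * g'`.
    let t := ρ g⁻¹ * T - 1
    have ht : ∀ x, ‖t - (ρ x - 1)‖ = ‖T - ρ (g * x)‖ := fun x => by
      rw [← hl g⁻¹ (T - _), mul_sub, ← map_mul, inv_mul_cancel_left, sub_sub_sub_cancel_right]
    have ht1 : ‖t‖ = ‖T - ρ g‖ := by simpa using ht 1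
    have hd : ‖ρ (g⁻¹ * g') - 1‖ < δ := by
      calc ‖ρ (g⁻¹ * g') - 1‖ = ‖t - (t - (ρ (g⁻¹ * g') - 1))‖ := by rw [sub_sub_cancel]
        _ ≤ ‖t‖ + ‖t - (ρ (g⁻¹ * g') - 1)‖ := norm_sub_le _ _
        _ ≤ ε + ε := by rw [ht, ht1, mul_inv_cancel_left, hg']; gcongr
        _ < δ := by linarith [min_le_left (δ / 3) (1 / 3)]
    obtain ⟨-, k, hk, hkk⟩ := hδN _ hd
    have h0 := eq_zero_of_norm_sub_sq (t := t) (a := ρ (g⁻¹ * g') - 1) (b := ρ k - 1)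
      (by rw [← hkk, map_mul]; noncomm_ring) hk
      (ht1 ▸ hTg.trans (min_le_right _ _)) (by rw [ht, ht1, mul_inv_cancel_left, hg'])
      (by rw [ht, ht1]; exact hmin _)
    rw [sub_eq_zero, ← map_one ρ] at h0
    exact (inv_mul_eq_one.1 (hinj h0)).symm
  refine ⟨g, (hδN g ?_).1, fun h => ?_⟩
  · calc ‖ρ g - 1‖ = ‖(T - 1) - (T - ρ g)‖ := by rw [sub_sub_sub_cancel_left]
      _ ≤ ‖T - 1‖ + ‖T - ρ g‖ := norm_sub_le _ _
      _ ≤ ε + ε := by gcongr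
      _ < δ := by linarith [min_le_left (δ / 3) (1 / 3)]
  · have := huniq (α h * g * (β h)⁻¹) (by
      rw [← hl (α h) (T - ρ g), ← hr (β h)⁻¹ (ρ (α h) * (T - ρ g)), mul_sub, sub_mul, hTα]
      simp only [map_mul])
    rw [mul_assoc, eq_inv_mul_iff_mul_eq]
    exact mul_inv_eq_iff_eq_mul.1 this |>.symm

end conj

/-! ### A faithful orthogonal representation of a universal subgroup -/

section Frobenius

variable {m : Type*} [Fintype m] [DecidableEq m]

attribute [local instance] Matrix.frobeniusNormedRing Matrix.frobeniusNormedSpace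

/-- The inner product `⟪a, b⟫ = tr (aᵀ b)` of real square matrices, compatible with the Frobenius
norm. -/
@[reducible]
def frobeniusInnerProductSpace : InnerProductSpace ℝ (Matrix m m ℝ) where
  inner a b := (a.transpose * b).trace
  norm_sq_eq_re_inner a := by
    rw [Matrix.frobenius_norm_def, ← Real.sqrt_eq_rpow, Real.sq_sqrt (by positivity),
      Finset.sum_comm]
    simp [Matrix.trace, Matrix.mul_apply, sq]
  conj_inner_symm a b := by
    simp [← Matrix.trace_transpose (a.transpose * b), Matrix.transpose_mul]
  add_left a b c := by simp [add_mul]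
  smul_left a b r := by simp

theorem continuous_frobenius {X : Type*} [TopologicalSpace X] {f : X → Matrix m m ℝ}
    (hf : ∀ i j, Continuous fun x => f x i j) : Continuous f := by
  have : f = fun x => ∑ i, ∑ j, f x i j • Matrix.single i j (1 : ℝ) := by
    ext1 x
    conv_lhs => rw [Matrix.matrix_eq_sum_single (f x)]
    simp
  rw [this]
  exact continuous_finsetSum _ fun i _ => continuous_finsetSum _ fun j _ =>
    (hf i j).smul continuous_const

theorem frobenius_norm_mul_left {u : Matrix m m ℝ} (hu : u.transpose * u = 1) (a : Matrix m m ℝ) :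
    ‖u * a‖ = ‖a‖ := by
  let _ := frobeniusInnerProductSpace (m := m)
  rw [norm_eq_sqrt_real_inner, norm_eq_sqrt_real_inner]
  change √((u * a).transpose * (u * a)).trace = √(a.transpose * a).trace
  rw [Matrix.transpose_mul, Matrix.mul_assoc, ← Matrix.mul_assoc _ u, hu, Matrix.one_mul]

theorem frobenius_norm_mul_right {u : Matrix m m ℝ} (hu : u.transpose * u = 1)
    (a : Matrix m m ℝ) : ‖a * u‖ = ‖a‖ := by
  rw [← Matrix.frobenius_norm_transpose, Matrix.transpose_mul,
    frobenius_norm_mul_left, Matrix.frobenius_norm_transpose]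
  rw [Matrix.transpose_transpose]
  exact mul_eq_one_comm.1 hu

end Frobenius

section representation

variable (G : UniversalSubgroup)

instance : CompactSpace G := isCompact_iff_compactSpace.1 G.isUniversal.isCompact

instance : T2Space G := inferInstanceAs (T2Space {f : LMonoid // f ∈ G.toSubmonoid})

/-- The smallest subspace of `ℝ^∞` that contains `ℝ^N` and is invariant under `G`. -/
def invariantHull (N : ℕ) : Submodule ℝ RInf :=
  ⨆ g : G, (RInf.stage N).map (g : LMonoid).toLinearMap

theorem stage_le_invariantHull (N : ℕ) : RInf.stage N ≤ invariantHull G N := by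
  refine le_iSup_of_le 1 ?_
  exact fun x hx => ⟨x, hx, rfl⟩

theorem apply_mem_invariantHull (N : ℕ) (g : G) {x : RInf} (hx : x ∈ invariantHull G N) :
    (g : LMonoid) x ∈ invariantHull G N := by
  have : invariantHull G N ≤ (invariantHull G N).comap (g : LMonoid).toLinearMap := by
    refine iSup_le fun g' => ?_
    rintro _ ⟨x, hx, rfl⟩
    exact le_iSup (fun g : G => (RInf.stage N).map (g : LMonoid).toLinearMap) (g * g')
      ⟨x, hx, rfl⟩
  exact this hx

instance (N : ℕ) : FiniteDimensional ℝ (invariantHull G N) := by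
  obtain ⟨M, hM⟩ := exists_maps_to_stage (f := fun g : G => (g : LMonoid))
    (fun u => (continuous_iff_eval.1 continuous_subtype_val u).2) (RInf.stage N)
  refine Submodule.finiteDimensional_of_le (S₂ := RInf.stage M) (iSup_le fun g => ?_)
  rintro _ ⟨x, hx, rfl⟩
  exact hM g x hx

/-- The subgroup of elements of `G` that fix `ℝ^N` pointwise. -/
def stageFixer (N : ℕ) : Subgroup G where
  carrier := {g | ∀ x ∈ RInf.stage N, (g : LMonoid) x = x}
  one_mem' _ _ := rfl
  mul_mem' {a b} ha hb x hx := by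
    change (a : LMonoid) ((b : LMonoid) x) = x
    rw [hb x hx, ha x hx]
  inv_mem' {a} ha x hx := by
    have h : ((a⁻¹ * a : G) : LMonoid) x = x := by rw [inv_mul_cancel]; rfl
    change ((a⁻¹ : G) : LMonoid) ((a : LMonoid) x) = x at h
    rwa [ha x hx] at h

/-- For some `N`, only the identity of `G` fixes `ℝ^N` pointwise: these pointwise fixers form a
decreasing sequence of closed subgroups with trivial intersection, so by compactness they are
eventually contained in any given neighbourhood of `1`, and `G` has no small subgroups. -/
theorem exists_stageFixer_eq_bot : ∃ N, stageFixer G N = ⊥ := by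
  obtain ⟨n, _, _⟩ := G.isUniversal.exists_lieGroup
  obtain ⟨U, hU, hsmall⟩ := exists_nhds_one_subgroup_eq_bot n G
  obtain ⟨O, hOU, hO, h1O⟩ := mem_nhds_iff.1 hU
  have hclosed : ∀ N, IsClosed (stageFixer G N : Set G) := fun N => by
    have : (stageFixer G N : Set G) = ⋂ x ∈ RInf.stage N, {g : G | (g : LMonoid) x = x} := by
      ext g
      simp only [Set.mem_iInter]
      rfl
    rw [this]
    exact isClosed_biInter fun x _ =>
      isClosed_eq ((continuous_eval x).comp continuous_subtype_val) continuous_const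
  by_contra! h
  obtain ⟨g, hg⟩ := IsCompact.nonempty_iInter_of_sequence_nonempty_isCompact_isClosed
    (fun N => (stageFixer G N : Set G) ∩ Oᶜ)
    (fun N => Set.inter_subset_inter_left _ fun g hg x hx =>
      hg x (RInf.stage_mono N.le_succ hx))
    (fun N => Set.inter_compl_nonempty_iff.2 fun hN => h N (hsmall _ (hN.trans hOU)))
    ((hclosed 0).inter hO.isClosed_compl).isCompact
    (fun N => (hclosed N).inter hO.isClosed_compl)
  have hg1 : g = 1 := Subtype.ext (LinearIsometry.ext fun x => by
    obtain ⟨N, hN⟩ := RInf.exists_mem_stage x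
    exact (Set.mem_iInter.1 hg N).1 x hN)
  exact (Set.mem_iInter.1 hg 0).2 (hg1 ▸ h1O)

/-- An orthonormal basis of the invariant hull of `ℝ^N`. -/
def hullBasis (N : ℕ) : OrthonormalBasis (Fin (Module.finrank ℝ (invariantHull G N))) ℝ
    (invariantHull G N) := stdOrthonormalBasis ℝ (invariantHull G N)

theorem apply_hullBasis (N : ℕ) (g : G) (j) : (g : LMonoid) (hullBasis G N j) =
    ∑ k, inner ℝ (hullBasis G N k : RInf) ((g : LMonoid) (hullBasis G N j)) •
      (hullBasis G N k : RInf) := by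
  let v : invariantHull G N :=
    ⟨(g : LMonoid) (hullBasis G N j), apply_mem_invariantHull G N g (hullBasis G N j).2⟩
  have hv := congrArg Subtype.val ((hullBasis G N).sum_repr' v)
  simpa [v] using hv.symm

/-- The matrix coefficients `⟪b i, g (b j)⟫` of `G` with respect to an orthonormal basis `b` of an
invariant subspace. -/
def matrixRep (N : ℕ) : G →* Matrix (Fin (Module.finrank ℝ (invariantHull G N)))
    (Fin (Module.finrank ℝ (invariantHull G N))) ℝ where
  toFun g := Matrix.of fun i j =>
    inner ℝ (hullBasis G N i : RInf) ((g : LMonoid) (hullBasis G N j))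
  map_one' := by
    ext i j
    have := orthonormal_iff_ite.1 (hullBasis G N).orthonormal i j
    simpa [Matrix.one_apply] using this
  map_mul' g g' := by
    ext i j
    change inner ℝ (hullBasis G N i : RInf) ((g : LMonoid) ((g' : LMonoid) (hullBasis G N j))) = _
    rw [apply_hullBasis]
    simp [Matrix.mul_apply, inner_sum, inner_smul_right, mul_comm]

theorem matrixRep_apply (N : ℕ) (g : G) (i j) : matrixRep G N g i j =
    inner ℝ (hullBasis G N i : RInf) ((g : LMonoid) (hullBasis G N j)) := rfl

theorem matrixRep_transpose_mul_self (N : ℕ) (g : G) :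
    (matrixRep G N g).transpose * matrixRep G N g = 1 := by
  ext i j
  have h : inner ℝ ((g : LMonoid) (hullBasis G N i)) ((g : LMonoid) (hullBasis G N j)) =
      (1 : Matrix _ _ ℝ) i j := by
    rw [LinearIsometry.inner_map_map, Matrix.one_apply]
    exact orthonormal_iff_ite.1 (hullBasis G N).orthonormal i j
  rw [← h, apply_hullBasis G N g i, sum_inner]
  simp [Matrix.mul_apply, matrixRep_apply, inner_smul_left]

theorem matrixRep_injective {N : ℕ} (hN : stageFixer G N = ⊥) :
    Function.Injective (matrixRep G N) := by
  refine (injective_iff_map_eq_one _).2 fun g hg => ?_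
  have hb : ∀ j, (g : LMonoid) (hullBasis G N j) = hullBasis G N j := fun j => by
    rw [apply_hullBasis]
    simp [← matrixRep_apply, hg, Matrix.one_apply]
  refine (Subgroup.eq_bot_iff_forall _).1 hN g fun x hx => ?_
  have := congrArg Subtype.val
    ((hullBasis G N).sum_repr' ⟨x, stage_le_invariantHull G N hx⟩)
  simp only [Submodule.coe_sum, Submodule.coe_smul] at this
  rw [← this, map_sum]
  simp [hb]

/-- Homomorphisms into a universal subgroup that are close to `α` are conjugate to `α` by elements
close to `1`. -/
theorem eventually_exists_conj_of_universal {H G : UniversalSubgroup} (α : HomSpace H G)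
    {N : Set G} (hN : N ∈ 𝓝 1) : ∀ᶠ β : HomSpace H G in 𝓝 α, ∃ g ∈ N, op g • α = β := by
  obtain ⟨M, hM⟩ := exists_stageFixer_eq_bot G
  obtain ⟨n, _, _⟩ := G.isUniversal.exists_lieGroup
  let m := Fin (Module.finrank ℝ (invariantHull G M))
  let _ : NormedRing (Matrix m m ℝ) := Matrix.frobeniusNormedRing
  let _ : InnerProductSpace ℝ (Matrix m m ℝ) := frobeniusInnerProductSpace
  have : FiniteDimensional ℝ (Matrix m m ℝ) := inferInstance
  have : CompleteSpace (Matrix m m ℝ) := FiniteDimensional.complete ℝ _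
  have hu := matrixRep_transpose_mul_self G M
  refine (eventually_exists_conj (map_sq_nhds_one n G) (matrixRep G M)
    (continuous_frobenius fun i j => ?_) (matrixRep_injective G hM)
    (fun g => frobenius_norm_mul_left (hu g)) (fun g => frobenius_norm_mul_right (hu g))
    α hN).mono fun β ⟨g, hg, h⟩ => ⟨g, hg, ContinuousMonoidHom.ext fun x => (h x).symm⟩
  exact continuous_const.inner ((continuous_eval _).comp continuous_subtype_val)

end representation

/-! ### The action of `H × G` on `E(H, G)` -/

section action

variable {H G : UniversalSubgroup}

theorem E.continuous_act : Continuous fun p : E H G × H × G => p.1.act p.2.1 p.2.2 := by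
  have hG : Continuous fun p : LMonoid × G => p.1 * (p.2 : LMonoid) :=
    continuous_mul_compact continuous_subtype_val
  have hH : Continuous fun p : LMonoid × H => ((p.2⁻¹ : H) : LMonoid) * p.1 :=
    continuous_compact_mul (continuous_subtype_val.comp continuous_inv)
  have : Continuous fun p : LMonoid × H × G =>
      ((p.2.1⁻¹ : H) : LMonoid) * p.1 * (p.2.2 : LMonoid) :=
    hG.comp ((hH.comp (continuous_fst.prodMk continuous_snd.fst)).prodMk continuous_snd.snd)
  exact this

theorem continuous_act_comp {P : Type*} [TopologicalSpace P] {x : P → E H G} {h : P → H}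
    {g : P → G} (hx : Continuous x) (hh : Continuous h) (hg : Continuous g) :
    Continuous fun p => (x p).act (h p) (g p) :=
  E.continuous_act.comp (g := fun p : E H G × H × G => p.1.act p.2.1 p.2.2)
    (hx.prodMk (hh.prodMk hg))

instance : T2Space (E H G) := inferInstanceAs (T2Space LMonoid)

instance : ContinuousConstSMul Gᵐᵒᵖ (E H G) where
  continuous_const_smul g := by
    change Continuous fun x : E H G => x.act 1 g.unop
    exact continuous_act_comp continuous_id continuous_const continuous_const

/-- `G` acts freely on `E(H, G)`, because isometries are injective. -/
theorem E.act_right_injective (x : E H G) (h : H) : Function.Injective (x.act h) := by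
  intro g g' hg
  refine Subtype.ext (LinearIsometry.ext fun u => ?_)
  have := DFunLike.congr_fun (F := LMonoid) hg u
  exact x.toL.injective (((h⁻¹ : H) : LMonoid).injective this)

theorem mem_fixedBy {α : HomSpace H G} {x : E H G} : x ∈ fixedBy α ↔ ∀ h, x.act h (α h) = x :=
  Iff.rfl

/-- A point of `E(H, G)` determines the homomorphism whose graph fixes it. -/
theorem eq_of_mem_fixedBy {α β : HomSpace H G} {x : E H G} (hα : x ∈ fixedBy α)
    (hβ : x ∈ fixedBy β) : α = β :=
  ContinuousMonoidHom.ext fun h => x.act_right_injective h ((hα h).trans (hβ h).symm)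

theorem smul_mem_fixedBy {α : HomSpace H G} {x : E H G} (hx : x ∈ fixedBy α) (g : Gᵐᵒᵖ) :
    g • x ∈ fixedBy (g • α) :=
  (g • (⟨(α, x), hx⟩ : ETilde H G)).2

/-- The translation function of the free action of the compact group `G` on `E(H, G)` is
continuous: its graph is closed. -/
theorem continuous_translation {P : Type*} [TopologicalSpace P] {x y : P → E H G} {γ : P → G}
    (hx : Continuous x) (hy : Continuous y) (h : ∀ p, (x p).act 1 (γ p) = y p) :
    Continuous γ := by
  refine continuous_iff_isClosed.2 fun C hC => ?_
  have hcl : IsClosed {q : P × G | (x q.1).act 1 q.2 = y q.1 ∧ q.2 ∈ C} :=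
    (isClosed_eq (continuous_act_comp (hx.comp continuous_fst) continuous_const continuous_snd)
      (hy.comp continuous_fst)).inter
      (hC.preimage continuous_snd)
  convert isClosedMap_fst_of_compactSpace _ hcl using 1
  ext p
  constructor
  · exact fun hp => ⟨(p, γ p), ⟨h p, hp⟩, rfl⟩
  · rintro ⟨⟨p, g⟩, ⟨hg, hgC⟩, rfl⟩
    have : g = γ p := (x p).act_right_injective 1 (hg.trans (h p).symm)
    exact this ▸ hgC

/-! ### The homomorphism attached to a point over `O_gl(H, G)` -/

theorem exists_act_eq_self {x : E H G}
    (hx : (Quotient.mk _ x : EModG H G) ∈ MulAction.fixedPoints Hᵐᵒᵖ (EModG H G)) (h : H) :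
    ∃ g : G, x.act h g = x := by
  obtain ⟨g, hg⟩ := Quotient.exact (hx (op h))
  change x.act 1 g.unop = x.act h 1 at hg
  refine ⟨g.unop⁻¹, ?_⟩
  have := congrArg (fun y => y.act 1 g.unop⁻¹) hg
  simp only [E.act_act, mul_one, one_mul, mul_inv_cancel] at this
  rw [← this, E.act_one]

theorem mk_mem_fixedPoints {α : HomSpace H G} {x : E H G} (hx : x ∈ fixedBy α) :
    (Quotient.mk _ x : EModG H G) ∈ MulAction.fixedPoints Hᵐᵒᵖ (EModG H G) := by
  intro h
  refine Quotient.sound ⟨op (α h.unop)⁻¹, ?_⟩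
  change x.act 1 (α h.unop)⁻¹ = x.act h.unop 1
  conv_lhs => rw [← mem_fixedBy.1 hx h.unop]
  simp [E.act_act]

variable (H G) in
/-- The points of `E(H, G)` whose `G`-orbit is fixed by `H`. -/
abbrev PreOGl : Type :=
  (Quotient.mk _ : E H G → EModG H G) ⁻¹' MulAction.fixedPoints Hᵐᵒᵖ (EModG H G)

/-- The unique `g ∈ G` with `x · (h, g) = x`. -/
def stabElt (x : PreOGl H G) (h : H) : G := (exists_act_eq_self x.2 h).choose

theorem act_stabElt (x : PreOGl H G) (h : H) : (x : E H G).act h (stabElt x h) = x :=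
  (exists_act_eq_self x.2 h).choose_spec

theorem continuous_stabElt : Continuous fun p : PreOGl H G × H => stabElt p.1 p.2 := by
  have hx : Continuous fun p : PreOGl H G × H => (p.1 : E H G) :=
    continuous_subtype_val.comp continuous_fst
  have hy : Continuous fun p : PreOGl H G × H => (p.1 : E H G).act p.2⁻¹ 1 :=
    continuous_act_comp hx continuous_snd.inv continuous_const
  refine continuous_translation hx hy fun p => ?_
  conv_rhs => rw [← act_stabElt p.1 p.2]
  simp [E.act_act]

theorem continuous_stabElt_right (x : PreOGl H G) : Continuous (stabElt x) := by
  have h : Continuous fun h : H => (x, h) := by fun_prop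
  simpa only [Function.comp_def] using continuous_stabElt.comp h

/-- The homomorphism `α` with `x ∈ E(H, G) ^ α`, for a point `x` whose `G`-orbit is fixed by `H`. -/
def stabHom (x : PreOGl H G) : HomSpace H G where
  toFun := stabElt x
  map_one' := (x : E H G).act_right_injective 1 ((act_stabElt x 1).trans (x : E H G).act_one.symm)
  map_mul' h h' := (x : E H G).act_right_injective (h * h') (by
    rw [act_stabElt, ← E.act_act, act_stabElt, act_stabElt])
  continuous_toFun := continuous_stabElt_right x

theorem mem_fixedBy_stabHom (x : PreOGl H G) : (x : E H G) ∈ fixedBy (stabHom x) := act_stabElt x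

theorem continuous_stabHom : Continuous (stabHom : PreOGl H G → HomSpace H G) :=
  (ContinuousMonoidHom.isInducing_toContinuousMap H G).continuous_iff.2
    (ContinuousMap.continuous_of_continuous_uncurry
      (fun x : PreOGl H G => (stabHom x).toContinuousMap) continuous_stabElt)

end action

/-! ### The homeomorphisms `ν` and `μ` -/

section homeo

variable (H G : UniversalSubgroup)

/-- The map `Ẽ(H, G) / G → O_gl(H, G)`, `[α, x] ↦ [x]`. -/
def forgetHom : ETildeModG H G → OGl H G :=
  Quotient.lift (fun p => ⟨Quotient.mk _ p.1.2, mk_mem_fixedPoints p.2⟩) (by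
    rintro _ p ⟨g, rfl⟩
    exact Subtype.ext (Quotient.sound ⟨g, rfl⟩))

/-- The inverse of `[α, x] ↦ [x]` is induced by `x ↦ (stabHom x, x)`. -/
theorem isHomeomorph_forgetHom : IsHomeomorph (forgetHom H G) where
  continuous := by
    refine Continuous.quotient_lift (Continuous.subtype_mk ?_ _) _
    exact continuous_quotient_mk'.comp (continuous_subtype_val.snd)
  isOpenMap := by
    intro S hS
    let τ : PreOGl H G → ETilde H G := fun x => ⟨(stabHom x, x), mem_fixedBy_stabHom x⟩
    have hτ : Continuous τ := (continuous_stabHom.prodMk continuous_subtype_val).subtype_mk _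
    have hπ := (isOpenMap_quotient_mk'_mul (Γ := Gᵐᵒᵖ) (T := E H G)).restrictPreimage
      (MulAction.fixedPoints Hᵐᵒᵖ (EModG H G))
    convert hπ _ ((hS.preimage continuous_quotient_mk').preimage hτ) using 1
    ext q
    constructor
    · rintro ⟨p, hp, rfl⟩
      induction p using Quotient.inductionOn with
      | _ p =>
        refine ⟨⟨p.1.2, mk_mem_fixedPoints p.2⟩, ?_, rfl⟩
        have hp' : τ ⟨p.1.2, mk_mem_fixedPoints p.2⟩ = p := Subtype.ext (Prod.ext
          (eq_of_mem_fixedBy (mem_fixedBy_stabHom ⟨p.1.2, mk_mem_fixedPoints p.2⟩) p.2) rfl)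
        change (Quotient.mk _ (τ ⟨p.1.2, mk_mem_fixedPoints p.2⟩) : ETildeModG H G) ∈ S
        rwa [hp']
    · rintro ⟨x, hx, rfl⟩
      exact ⟨_, hx, rfl⟩
  bijective := by
    constructor
    · intro p q h
      induction p, q using Quotient.inductionOn₂ with
      | _ p q =>
        obtain ⟨g, hg⟩ := Quotient.exact (congrArg Subtype.val h)
        refine Quotient.sound ⟨g, Subtype.ext (Prod.ext ?_ hg)⟩
        refine eq_of_mem_fixedBy (smul_mem_fixedBy q.2 g) ?_
        change g • q.1.2 = p.1.2 at hg
        rw [hg]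
        exact p.2
    · rintro ⟨q, hq⟩
      induction q using Quotient.inductionOn with
      | _ x => exact ⟨Quotient.mk _ ⟨(stabHom ⟨x, hq⟩, x), mem_fixedBy_stabHom ⟨x, hq⟩⟩, rfl⟩

variable {H G}

/-- A point of `Ẽ(H, G)` over a conjugate of `α` is equivalent to a point over `α`. -/
theorem exists_mk_eq_mk {α : HomSpace H G} {q : ETilde H G} {k : G} (h : op k • α = q.1.1) :
    ∃ hx : q.1.2.act 1 k⁻¹ ∈ fixedBy α,
      (Quotient.mk _ ⟨(α, q.1.2.act 1 k⁻¹), hx⟩ : ETildeModG H G) = Quotient.mk _ q := by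
  have hα : op k⁻¹ • q.1.1 = α := by
    rw [← h, smul_smul, ← op_mul, mul_inv_cancel, op_one, one_smul]
  have hx : q.1.2.act 1 k⁻¹ ∈ fixedBy α := by
    rw [← hα]
    exact smul_mem_fixedBy q.2 (op k⁻¹)
  exact ⟨hx, Quotient.sound ⟨op k⁻¹, Subtype.ext (Prod.ext hα rfl)⟩⟩

/-- The map `E(H, G) ^ α → Ẽ(H, G)`, `x ↦ (α, x)`. -/
def fixedToETilde (α : HomSpace H G) (x : fixedBy α) : ETilde H G := ⟨(α, x), x.2⟩

theorem continuous_fixedToETilde (α : HomSpace H G) : Continuous (fixedToETilde α) :=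
  (continuous_const.prodMk continuous_subtype_val).subtype_mk _

/-- The map `E(H, G) ^ α / C(α) → Ẽ(H, G) / G`, `[x] ↦ [α, x]`. -/
def fixedModToETildeMod (α : HomSpace H G) : FixedModCent α → ETildeModG H G :=
  Quotient.lift (fun x => Quotient.mk _ (fixedToETilde α x)) (by
    rintro _ x ⟨c, rfl⟩
    refine Quotient.sound ⟨op (c.unop : G), Subtype.ext (Prod.ext ?_ rfl)⟩
    refine ContinuousMonoidHom.ext fun h => ?_
    change (c.unop : G)⁻¹ * α h * c.unop = α h
    have hc : α h * c.unop = c.unop * α h :=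
      Subgroup.mem_centralizer_iff.1 c.unop.2 (α h) ⟨h, rfl⟩
    rw [mul_assoc, hc, inv_mul_cancel_left])

theorem continuous_fixedModToETildeMod (α : HomSpace H G) : Continuous (fixedModToETildeMod α) :=
  Continuous.quotient_lift (continuous_quotient_mk'.comp (continuous_fixedToETilde α)) _

/-- Openness of the components of `μ`: close to a point over `α`, all points of `Ẽ(H, G)` lie over
conjugates of `α` by elements of `G` close to `1`, so they are translates of nearby points of
`E(H, G) ^ α`. -/
theorem isOpenMap_fixedModToETildeMod (α : HomSpace H G) : IsOpenMap (fixedModToETildeMod α) := by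
  intro V hV
  obtain ⟨O, hO, hVO⟩ := isOpen_induced_iff.1 (hV.preimage continuous_quotient_mk')
  have hVO' : ∀ x : fixedBy α, (x : E H G) ∈ O ↔ (Quotient.mk _ x : FixedModCent α) ∈ V :=
    fun x => Set.ext_iff.1 hVO x
  refine isOpen_coinduced.2 (isOpen_iff_mem_nhds.2 ?_)
  rintro p ⟨v, hv, hvp⟩
  induction v using Quotient.inductionOn with
  | _ x₀ =>
  obtain ⟨g₀, hg₀⟩ := Quotient.exact hvp.symm
  have hp1 : g₀ • α = p.1.1 := congrArg (fun p : ETilde H G => p.1.1) hg₀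
  have hp2 : (x₀ : E H G).act 1 g₀.unop = p.1.2 := congrArg (fun p : ETilde H G => p.1.2) hg₀
  have hc : Continuous fun q : E H G × G => q.1.act 1 (g₀.unop * q.2)⁻¹ :=
    continuous_act_comp continuous_fst continuous_const
      (continuous_const.mul continuous_snd).inv
  have hp : p.1.2.act 1 (g₀.unop * 1)⁻¹ = (x₀ : E H G) := by
    rw [← hp2, E.act_act, mul_one, mul_one, mul_inv_cancel, E.act_one]
  have hO' : (fun q : E H G × G => q.1.act 1 (g₀.unop * q.2)⁻¹) ⁻¹' O ∈ 𝓝 (p.1.2, (1 : G)) :=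
    (hO.preimage hc).mem_nhds (hp.symm ▸ (hVO' x₀).2 hv :)
  rw [nhds_prod_eq] at hO'
  obtain ⟨Y, hY, N, hN, hYN⟩ := mem_prod_iff.1 hO'
  have h1 : ∀ᶠ q : ETilde H G in 𝓝 p, ∃ g ∈ N, op g • p.1.1 = q.1.1 :=
    (continuous_subtype_val.fst.tendsto p).eventually
      (eventually_exists_conj_of_universal p.1.1 hN)
  have h2 : ∀ᶠ q : ETilde H G in 𝓝 p, q.1.2 ∈ Y :=
    (continuous_subtype_val.snd.tendsto p).eventually hY
  filter_upwards [h1, h2] with q ⟨g, hg, hgq⟩ hqY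
  have hα : op (g₀.unop * g) • α = q.1.1 := by
    rw [← hgq, ← hp1, smul_smul, op_mul, op_unop]
  obtain ⟨hx, hxq⟩ := exists_mk_eq_mk hα
  have hxO : q.1.2.act 1 (g₀.unop * g)⁻¹ ∈ O := by
    have hqg : (q.1.2, g) ∈ Y ×ˢ N := ⟨hqY, hg⟩
    simpa only [Set.mem_preimage] using hYN hqg
  exact ⟨Quotient.mk _ ⟨_, hx⟩, (hVO' ⟨_, hx⟩).1 hxO, hxq⟩

variable {ι : Type*} (α : ι → HomSpace H G)

/-- The map `∐ E(H, G) ^ (α i) / C(α i) → Ẽ(H, G) / G`, `[x] ↦ [α i, x]`. -/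
def sigmaToETildeMod (p : Σ i, FixedModCent (α i)) : ETildeModG H G :=
  fixedModToETildeMod (α p.1) p.2

theorem isHomeomorph_sigmaToETildeMod
    (hα : Function.Bijective (fun i => (Quotient.mk _ (α i) : Rep H G))) :
    IsHomeomorph (sigmaToETildeMod α) where
  continuous := continuous_sigma fun i => continuous_fixedModToETildeMod (α i)
  isOpenMap := isOpenMap_sigma.2 fun i => isOpenMap_fixedModToETildeMod (α i)
  bijective := by
    constructor
    · rintro ⟨i, v⟩ ⟨j, w⟩ h
      induction v, w using Quotient.inductionOn₂ with
      | _ x y =>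
      obtain ⟨g, hg⟩ := Quotient.exact h
      have hg1 : g • α j = α i := congrArg (fun p : ETilde H G => p.1.1) hg
      have hg2 : g • (y : E H G) = x := congrArg (fun p : ETilde H G => p.1.2) hg
      obtain rfl : i = j := hα.1 (Quotient.sound ⟨g, hg1⟩)
      have hgc : g.unop ∈ cent (α i) := by
        rw [Subgroup.mem_centralizer_iff]
        rintro _ ⟨h, rfl⟩
        have : g.unop⁻¹ * α i h * g.unop = α i h := DFunLike.congr_fun hg1 h
        rw [mul_assoc, inv_mul_eq_iff_eq_mul] at this
        exact this
      refine congrArg (Sigma.mk i) (Quotient.sound ⟨op ⟨g.unop, hgc⟩, Subtype.ext hg2⟩)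
    · intro q
      induction q using Quotient.inductionOn with
      | _ p =>
      obtain ⟨i, hi⟩ := hα.2 (Quotient.mk _ p.1.1)
      obtain ⟨g, hg⟩ := Quotient.exact hi
      change g • p.1.1 = α i at hg
      have hg' : op g.unop⁻¹ • α i = p.1.1 := by
        rw [← hg, op_inv, op_unop, inv_smul_smul]
      obtain ⟨hx, hxp⟩ := exists_mk_eq_mk hg'
      exact ⟨⟨i, Quotient.mk _ ⟨_, hx⟩⟩, hxp⟩

end homeo

end

end OrbiGl

open OrbiGl in
theorem proposition2p20 (H G : UniversalSubgroup) :
    ∃ ν : ETildeModG H G ≃ₜ OGl H G,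
      (∀ (α : HomSpace H G) (x : E H G) (hx : x ∈ fixedBy α),
        (ν (Quotient.mk _ ⟨(α, x), hx⟩) : EModG H G) = Quotient.mk _ x) ∧
      ∀ {ι : Type*} (α : ι → HomSpace H G),
        Function.Bijective (fun i => (Quotient.mk _ (α i) : Rep H G)) →
        ∃ (μ : (Σ i, FixedModCent (α i)) ≃ₜ ETildeModG H G)
          (l : (Σ i, FixedModCent (α i)) ≃ₜ OGl H G),
          (∀ (i : ι) (x : E H G) (hx : x ∈ fixedBy (α i)),
            μ ⟨i, Quotient.mk _ ⟨x, hx⟩⟩ = Quotient.mk _ ⟨(α i, x), hx⟩) ∧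
          (∀ (i : ι) (x : E H G) (hx : x ∈ fixedBy (α i)),
            (l ⟨i, Quotient.mk _ ⟨x, hx⟩⟩ : EModG H G) = Quotient.mk _ x) ∧
          ∀ q, ν (μ q) = l q := by
  let ν := (isHomeomorph_forgetHom H G).homeomorph
  refine ⟨ν, fun _ _ _ => rfl, fun α hα => ?_⟩
  let μ := (isHomeomorph_sigmaToETildeMod α hα).homeomorph
  exact ⟨μ, μ.trans ν, fun _ _ _ => rfl, fun _ _ _ => rfl, fun _ => rfl⟩
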